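/- Let $\mathcal H$ be a real Hilbert space, let $J$ be a bounded operator on $\mathcal H$ with $J^2=-1$ and $J^*=-J$ (a complex structure), and let $w(\xi,\eta)=\langle J\xi,\eta\rangle$ be the associated symplectic form. Let $\mathcal B_2(\mathcal H)$ be the space of Hilbert–Schmidt operators on $\mathcal H$, with the norm $\|a\|_2={\rm Tr}(a^*a)^{1/2}$. Let $${\rm Sp}_2(\mathcal H)=\{g\in GL(\mathcal H): w(g\xi,g\eta)=w(\xi,\eta)\ \text{for all}\ \xi,\eta\in\mathcal H,\ g-1\in\mathcal B_2(\mathcal H)\},$$ with the metric $\|g_1-g_2\|_2$, let $$\mathfrak{sp}_2(\mathcal H)=\{x\in\mathcal B_2(\mathcal H): xJ=-Jx^*\},$$ with the norm $\|\cdot\|_2$, and let $$U_2(\mathcal H_J)=\{g \ \text{unitary on}\ \mathcal H:\ g-1\in\mathcal B_2(\mathcal H),\ gJ=Jg\}.$$ Then ${\rm Sp}_2(\mathcal H)$ is a real analytic Banach–Lie group modelled on $\mathfrak{sp}_2(\mathcal H)$, with the manifold structure of an embedded split submanifold of the affine Banach space $1+\mathcal B_2(\mathcal H)$, and $U_2(\mathcal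 H_J)$ is a Banach–Lie subgroup of ${\rm Sp}_2(\mathcal H)$. That is, $U_2(\mathcal H_J)$ is a subgroup of ${\rm Sp}_2(\mathcal H)$ which, with the topology inherited from ${\rm Sp}_2(\mathcal H)$, is a real analytic Banach–Lie group such that the inclusion $U_2(\mathcal H_J)\hookrightarrow{\rm Sp}_2(\mathcal H)$ is a real analytic split embedding (a topological embedding that in suitable charts has the form $u\mapsto(u,0)$, onto a complemented closed subspace of the model space). -/

import Mathlib

open scoped ContDiff Manifold

noncomputable section

namespace RestrictedSymplectic

universe u

section HilbertSchmidt

variable (H : Type*) [NormedAddCommGroup H] [InnerProductSpace ℝ H] [CompleteSpace H]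

/-- Index set of a chosen orthonormal basis of `H`. -/
def basisIndex : Set H := (exists_hilbertBasis ℝ H).choose

/-- A chosen orthonormal basis of `H`. By `isHilbertSchmidt_iff` and `HilbertSchmidt.norm_sq_eq`
below, nothing depends on the choice. -/
def basis : HilbertBasis (basisIndex H) ℝ H := (exists_hilbertBasis ℝ H).choose_spec.choose

variable {H}

/-- `a` is Hilbert-Schmidt: `Tr (a* a) = ∑ i, ⟪a* a eᵢ, eᵢ⟫ = ∑ i, ‖a eᵢ‖ ^ 2` is finite. -/
def IsHilbertSchmidt (a : H →L[ℝ] H) : Prop :=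
  Summable fun i => ‖a (basis H i)‖ ^ 2

set_option linter.unusedSectionVars false in
theorem summable_iff_tsum_enorm {ι : Type*} (f : ι → H) :
    (Summable fun i => ‖f i‖ ^ 2) ↔ ∑' i, ‖f i‖ₑ ^ 2 ≠ ⊤ := by
  have h : ∀ i, ‖f i‖ₑ ^ 2 = (((‖f i‖₊ ^ 2 : NNReal)) : ENNReal) := fun i => by
    rw [ENNReal.coe_pow]; rfl
  simp_rw [h]
  rw [ENNReal.tsum_coe_ne_top_iff_summable, ← NNReal.summable_coe]
  simp

set_option linter.unusedSectionVars false in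
theorem tsum_enorm_basis {ι : Type*} (b : HilbertBasis ι ℝ H) (x : H) :
    ∑' i, ‖inner ℝ (b i) x‖ₑ ^ 2 = ‖x‖ₑ ^ 2 := by
  have h : ∀ r : ℝ, ‖r‖ₑ ^ 2 = ENNReal.ofReal (‖r‖ ^ 2) := fun r => by
    rw [ENNReal.ofReal_pow (norm_nonneg _), ofReal_norm]
  have hs := b.hasSum_inner_mul_inner x x
  have hs' : HasSum (fun i => ‖inner ℝ (b i) x‖ ^ 2) (‖x‖ ^ 2) := by
    have e : (fun i => ‖inner ℝ (b i) x‖ ^ 2) =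
        fun i => inner ℝ x (b i) * inner ℝ (b i) x := by
      funext i
      rw [Real.norm_eq_abs, sq_abs, real_inner_comm x (b i), sq]
    rw [e, ← real_inner_self_eq_norm_sq]
    exact hs
  simp_rw [h]
  rw [← ENNReal.ofReal_tsum_of_nonneg (fun _ => by positivity) hs'.summable, hs'.tsum_eq,
    ENNReal.ofReal_pow (norm_nonneg _), ofReal_norm]

theorem tsum_enorm_adjoint {ι κ : Type*} (b : HilbertBasis ι ℝ H) (c : HilbertBasis κ ℝ H)
    (a : H →L[ℝ] H) :
    ∑' i, ‖a (b i)‖ₑ ^ 2 = ∑' j, ‖ContinuousLinearMap.adjoint a (c j)‖ₑ ^ 2 := by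
  calc ∑' i, ‖a (b i)‖ₑ ^ 2 = ∑' i, ∑' j, ‖inner ℝ (c j) (a (b i))‖ₑ ^ 2 := by
        simp_rw [tsum_enorm_basis c]
    _ = ∑' j, ∑' i, ‖inner ℝ (c j) (a (b i))‖ₑ ^ 2 := ENNReal.tsum_comm
    _ = ∑' j, ∑' i, ‖inner ℝ (b i) (ContinuousLinearMap.adjoint a (c j))‖ₑ ^ 2 := by
        simp_rw [ContinuousLinearMap.adjoint_inner_right, real_inner_comm]
    _ = _ := by simp_rw [tsum_enorm_basis b]

theorem tsum_enorm_eq {ι κ : Type*} (b : HilbertBasis ι ℝ H) (c : HilbertBasis κ ℝ H)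
    (a : H →L[ℝ] H) : ∑' i, ‖a (b i)‖ₑ ^ 2 = ∑' j, ‖a (c j)‖ₑ ^ 2 := by
  rw [tsum_enorm_adjoint b c a, ← tsum_enorm_adjoint c c a]

/-- Being Hilbert-Schmidt does not depend on the orthonormal basis. -/
theorem isHilbertSchmidt_iff {ι : Type*} (b : HilbertBasis ι ℝ H) (a : H →L[ℝ] H) :
    IsHilbertSchmidt a ↔ Summable fun i => ‖a (b i)‖ ^ 2 := by
  rw [IsHilbertSchmidt, summable_iff_tsum_enorm (fun i => a (basis H i)),
    summable_iff_tsum_enorm (fun i => a (b i)), tsum_enorm_eq (basis H) b]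

theorem isHilbertSchmidt_iff_memℓp (a : H →L[ℝ] H) :
    IsHilbertSchmidt a ↔ Memℓp (fun i => a (basis H i)) 2 := by
  rw [memℓp_gen_iff (by norm_num), IsHilbertSchmidt]
  norm_num

theorem IsHilbertSchmidt.adjoint {a : H →L[ℝ] H} (ha : IsHilbertSchmidt a) :
    IsHilbertSchmidt (ContinuousLinearMap.adjoint a) := by
  rw [IsHilbertSchmidt, summable_iff_tsum_enorm] at *
  rwa [← tsum_enorm_adjoint (basis H) (basis H) a]

theorem IsHilbertSchmidt.mul_left {a : H →L[ℝ] H} (ha : IsHilbertSchmidt a) (c : H →L[ℝ] H) :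
    IsHilbertSchmidt (c * a) := by
  refine Summable.of_nonneg_of_le (fun _ => by positivity) (fun i => ?_)
    (Summable.mul_left (‖c‖ ^ 2) ha)
  rw [← mul_pow]
  gcongr
  exact c.le_opNorm _

theorem IsHilbertSchmidt.mul_right {a : H →L[ℝ] H} (ha : IsHilbertSchmidt a) (c : H →L[ℝ] H) :
    IsHilbertSchmidt (a * c) := by
  have h := (ha.adjoint.mul_left (ContinuousLinearMap.adjoint c)).adjoint
  have e : ContinuousLinearMap.adjoint
      (ContinuousLinearMap.adjoint c * ContinuousLinearMap.adjoint a) = a * c := by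
    simp only [← ContinuousLinearMap.star_eq_adjoint, star_mul, star_star]
  rwa [e] at h

variable (H)

/-- The Hilbert-Schmidt operators as a linear subspace of the bounded operators. -/
def hilbertSchmidtSubmodule : Submodule ℝ (H →L[ℝ] H) where
  carrier := {a | IsHilbertSchmidt a}
  zero_mem' := by simp [IsHilbertSchmidt, summable_zero]
  add_mem' {a b} ha hb := by
    rw [Set.mem_ofPred_eq, isHilbertSchmidt_iff_memℓp] at *
    exact ha.add hb
  smul_mem' c a ha := by
    rw [Set.mem_ofPred_eq, isHilbertSchmidt_iff_memℓp] at *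
    exact ha.const_smul c

/-- The space `B₂(H)` of Hilbert-Schmidt operators. It is a type of its own, so that it carries the
norm `‖a‖₂ = Tr (a* a) ^ (1/2)` and not the operator norm. -/
def HilbertSchmidt : Type _ := ↥(hilbertSchmidtSubmodule H)

namespace HilbertSchmidt

instance : AddCommGroup (HilbertSchmidt H) :=
  inferInstanceAs (AddCommGroup ↥(hilbertSchmidtSubmodule H))

instance : Module ℝ (HilbertSchmidt H) :=
  inferInstanceAs (Module ℝ ↥(hilbertSchmidtSubmodule H))

/-- The underlying bounded operator. -/
def toOp : HilbertSchmidt H →ₗ[ℝ] (H →L[ℝ] H) := (hilbertSchmidtSubmodule H).subtype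

/-- The family `(a eᵢ)ᵢ` in `ℓ²`. Its norm is `(∑ i, ‖a eᵢ‖ ^ 2) ^ (1/2)`. -/
def toLp : HilbertSchmidt H →ₗ[ℝ] lp (fun _ : basisIndex H => H) 2 where
  toFun a := ⟨fun i => toOp H a (basis H i), (isHilbertSchmidt_iff_memℓp _).1 a.2⟩
  map_add' _ _ := rfl
  map_smul' _ _ := rfl

theorem toLp_injective : Function.Injective (toLp H) := by
  intro a b h
  apply Subtype.ext
  refine ContinuousLinearMap.ext_on (s := Set.range (basis H)) ?_ ?_
  · have := (basis H).dense_span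
    rw [dense_iff_closure_eq, ← Submodule.topologicalClosure_coe, this]
    rfl
  · rintro _ ⟨i, rfl⟩
    exact congrFun (congrArg Subtype.val h) i

instance : NormedAddCommGroup (HilbertSchmidt H) :=
  NormedAddCommGroup.induced _ _ (toLp H) (toLp_injective H)

instance : NormedSpace ℝ (HilbertSchmidt H) :=
  NormedSpace.induced ℝ _ _ (toLp H)

/-- `‖a‖₂ ^ 2 = ∑ i, ‖a bᵢ‖ ^ 2` for every orthonormal basis `b`. -/
theorem norm_sq_eq {ι : Type*} (b : HilbertBasis ι ℝ H) (a : HilbertSchmidt H) :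
    ‖a‖ ^ 2 = ∑' i, ‖toOp H a (b i)‖ ^ 2 := by
  have key : ∀ {κ : Type _} (c : HilbertBasis κ ℝ H),
      ∑' i, ‖toOp H a (c i)‖ ^ 2 = (∑' i, ‖toOp H a (c i)‖ₑ ^ 2).toReal := by
    intro κ c
    rw [ENNReal.tsum_toReal_eq (fun i => by finiteness)]
    simp
  have key' : ∑' i, ‖toOp H a (b i)‖ ^ 2 = (∑' i, ‖toOp H a (b i)‖ₑ ^ 2).toReal := by
    rw [ENNReal.tsum_toReal_eq (fun i => by finiteness)]
    simp
  rw [key', tsum_enorm_eq b (basis H), ← key]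
  have h := lp.norm_rpow_eq_tsum (p := 2) (by norm_num) (toLp H a)
  norm_num at h
  exact h

end HilbertSchmidt

/-- The invertible operators `g` with `g - 1` Hilbert-Schmidt. -/
def gl2Subgroup : Subgroup (H →L[ℝ] H)ˣ where
  carrier := {g | IsHilbertSchmidt ((g : H →L[ℝ] H) - 1)}
  one_mem' := by
    rw [Set.mem_ofPred_eq, Units.val_one, sub_self]
    exact (hilbertSchmidtSubmodule H).zero_mem
  mul_mem' {g h} hg hh := by
    have e : ((g * h : (H →L[ℝ] H)ˣ) : H →L[ℝ] H) - 1 =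
        ((g : H →L[ℝ] H) - 1) * h + ((h : H →L[ℝ] H) - 1) := by
      rw [sub_mul, one_mul, Units.val_mul]; abel
    rw [Set.mem_ofPred_eq, e]
    exact (hilbertSchmidtSubmodule H).add_mem (IsHilbertSchmidt.mul_right hg _) hh
  inv_mem' {g} hg := by
    have e : ((g⁻¹ : (H →L[ℝ] H)ˣ) : H →L[ℝ] H) - 1 =
        -(((g : H →L[ℝ] H) - 1) * (g⁻¹ : (H →L[ℝ] H)ˣ)) := by
      rw [sub_mul, one_mul, Units.mul_inv]; abel
    rw [Set.mem_ofPred_eq, e]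
    exact (hilbertSchmidtSubmodule H).neg_mem (IsHilbertSchmidt.mul_right hg _)

/-- The group `GL₂(H)` of the invertible operators `g` with `g - 1` Hilbert-Schmidt. It is a type of
its own, so that it carries the metric `‖g₁ - g₂‖₂` and not the topology of the operator norm. -/
def GL2 : Type _ := ↥(gl2Subgroup H)

namespace GL2

instance : Group (GL2 H) := inferInstanceAs (Group ↥(gl2Subgroup H))

variable {H}

/-- The underlying bounded operator. -/
def toOp (g : GL2 H) : H →L[ℝ] H := (g.1 : H →L[ℝ] H)

/-- `g - 1`, as a Hilbert-Schmidt operator. -/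
def subOne (g : GL2 H) : HilbertSchmidt H := ⟨toOp g - 1, g.2⟩

theorem subOne_injective : Function.Injective (subOne (H := H)) := by
  intro g h e
  have e' : toOp g - 1 = toOp h - 1 := congrArg Subtype.val e
  exact Subtype.ext (Units.ext (sub_left_injective e'))

/-- The metric `dist g₁ g₂ = ‖g₁ - g₂‖₂`. -/
instance : MetricSpace (GL2 H) := MetricSpace.induced subOne subOne_injective inferInstance

end GL2

end HilbertSchmidt

section Symplectic

variable {H : Type*} [NormedAddCommGroup H] [InnerProductSpace ℝ H] [CompleteSpace H]

/-- The form `w(ξ, η) = ⟪J ξ, η⟫`. -/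
def symplecticForm (J : H →L[ℝ] H) (ξ η : H) : ℝ := inner ℝ (J ξ) η

/-- The restricted symplectic group `Sp₂(H)`, with the metric `‖g₁ - g₂‖₂` inherited from
`GL₂(H)`. -/
def Sp2 (J : H →L[ℝ] H) : Subgroup (GL2 H) where
  carrier := {g | ∀ ξ η, symplecticForm J (g.toOp ξ) (g.toOp η) = symplecticForm J ξ η}
  one_mem' _ _ := rfl
  mul_mem' {g h} hg hh ξ η := (hg (h.toOp ξ) (h.toOp η)).trans (hh ξ η)
  inv_mem' {g} hg ξ η := by
    have e : ∀ x, g.toOp ((g⁻¹).toOp x) = x := fun x =>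
      DFunLike.congr_fun (Units.mul_inv g.1) x
    have := hg ((g⁻¹).toOp ξ) ((g⁻¹).toOp η)
    rw [e, e] at this
    exact this.symm

variable (H) in
/-- The group `U₂(H)` of the unitary (orthogonal) operators `g` with `g - 1` Hilbert-Schmidt. -/
def U2 : Subgroup (GL2 H) where
  carrier := {g | g.toOp ∈ unitary (H →L[ℝ] H)}
  one_mem' := (unitary (H →L[ℝ] H)).one_mem
  mul_mem' hg hh := (unitary (H →L[ℝ] H)).mul_mem hg hh
  inv_mem' {g} hg := by
    have e : (g⁻¹).toOp = star g.toOp :=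
      (left_inv_eq_right_inv (Unitary.star_mul_self_of_mem hg) (Units.mul_inv g.1)).symm
    rw [Set.mem_ofPred_eq, e]
    exact Unitary.star_mem hg

/-- The group `U₂(H_J)` of the elements of `U₂(H)` that commute with `J`. -/
def U2J (J : H →L[ℝ] H) : Subgroup (GL2 H) where
  carrier := {g | g ∈ U2 H ∧ g.toOp * J = J * g.toOp}
  one_mem' := ⟨(U2 H).one_mem, (one_mul J).trans (mul_one J).symm⟩
  mul_mem' {g h} hg hh := ⟨(U2 H).mul_mem hg.1 hh.1,
    (Commute.mul_left (a := g.toOp) (b := h.toOp) (c := J) hg.2 hh.2)⟩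
  inv_mem' {g} hg := ⟨(U2 H).inv_mem hg.1,
    (Commute.units_inv_left (u := g.1) (a := J) hg.2)⟩

/-- The Lie algebra `𝔰𝔭₂(H) = {x ∈ B₂(H) : x J = - J x*}`, with the norm `‖x‖₂`. -/
def sp2 (J : H →L[ℝ] H) : Submodule ℝ (HilbertSchmidt H) where
  carrier := {x | HilbertSchmidt.toOp H x * J =
    -(J * ContinuousLinearMap.adjoint (HilbertSchmidt.toOp H x))}
  zero_mem' := by simp
  add_mem' {x y} hx hy := by
    rw [Set.mem_ofPred_eq] at *
    rw [map_add, map_add, add_mul, hx, hy, mul_add, neg_add]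
  smul_mem' c x hx := by
    rw [Set.mem_ofPred_eq] at *
    rw [LinearMap.map_smul, smul_mul_assoc, hx, LinearIsometryEquiv.map_smulₛₗ]
    simp

/-- `Sp₂(H)` with the given charts, modelled on `𝔰𝔭₂(H)`, is a (real analytic) Banach-Lie group, and
its manifold structure is that of an embedded split submanifold of the affine Banach space
`1 + B₂(H)`, which is identified with `B₂(H)` by `g ↦ g - 1`. There is at most one such manifold
structure. -/
structure IsSp2LieStructure (J : H →L[ℝ] H) (A : ChartedSpace (sp2 J) (Sp2 J)) : Prop where
  complete : CompleteSpace (sp2 J)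
  lieGroup : LieGroup 𝓘(ℝ, sp2 J) ω (Sp2 J)
  embedding : Manifold.IsSmoothEmbedding 𝓘(ℝ, sp2 J) 𝓘(ℝ, HilbertSchmidt H) ω
    (fun g : Sp2 J => GL2.subOne (g : GL2 H))

end Symplectic

/-- `K` is a Banach-Lie subgroup of the Banach-Lie group `G`: with the topology inherited from `G`,
it is a Banach-Lie group, and the inclusion is a (real analytic, split) embedding. -/
def IsBanachLieSubgroup (E : Type u) [NormedAddCommGroup E] [NormedSpace ℝ E]
    {G : Type*} [Group G] [TopologicalSpace G] [ChartedSpace E G] (K : Subgroup G) : Prop :=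
  ∃ (F : Type u) (_ : NormedAddCommGroup F) (_ : NormedSpace ℝ F) (_ : ChartedSpace F K),
    CompleteSpace F ∧ LieGroup 𝓘(ℝ, F) ω K ∧
      Manifold.IsSmoothEmbedding 𝓘(ℝ, F) 𝓘(ℝ, E) ω (Subtype.val : K → G)

end RestrictedSymplectic

end

/-! The Cayley transform straightens both groups at once. For `g = 1 + a` put `y = (2 + a)⁻¹ a`, so
that `g = (1 + y)(1 - y)⁻¹`. For any bounded `b`, the quadratic equation `g* b g = b` becomes the
linear one `y* b + b y = 0` (`cayley_form_iff`), and commuting with `b` is preserved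
(`cayley_commute_iff`). With `b = J` this turns `Sp₂(H)` near `1` into an open piece of `𝔰𝔭₂(H)`.
With `b = 1` and commutation with `J` it turns `U₂(H_J)` into an open piece of its Lie algebra
`u2J`. Left translations carry the chart to every other point. Both Lie algebras are complemented,
by averaging over finite groups of involutions.

A `SliceAtlas` records such ambient charts, and yields an embedded split submanifold. Multiplication
and inversion are analytic in the ambient coordinate `g - 1`, and a continuous map into an immersed
manifold is analytic once its composite with the immersion is, so both groups are Lie groups. The
same ambient charts serve both groups, so the inclusion is linear in coordinates. For an arbitrary
admissible structure on `Sp₂(H)` this suffices, because `sliceChart_mem_maximalAtlas` puts the slice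
charts in its maximal atlas. -/

noncomputable section Slices

/-! ### Submanifolds of a normed space given by straightening charts -/

open Set Topology Manifold

variable {𝕜 : Type*} [NontriviallyNormedField 𝕜]
  {V : Type*} [NormedAddCommGroup V] [NormedSpace 𝕜 V]
  {E : Type*} [NormedAddCommGroup E] [NormedSpace 𝕜 E]
  {F : Type*} [NormedAddCommGroup F] [NormedSpace 𝕜 F]
  {M : Type*} [TopologicalSpace M] {K : Type*} [TopologicalSpace K] {n : ℕ∞ω}

/-- A homeomorphism onto an open subset of the model space which is `C^n` in both directions is a
chart of the maximal atlas. -/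
theorem IsManifold.mem_maximalAtlas_of_contMDiffOn [ChartedSpace E M] [IsManifold 𝓘(𝕜, E) n M]
    {e : OpenPartialHomeomorph M E} (he : ContMDiffOn 𝓘(𝕜, E) 𝓘(𝕜, E) n e e.source)
    (he' : ContMDiffOn 𝓘(𝕜, E) 𝓘(𝕜, E) n e.symm e.target) :
    e ∈ IsManifold.maximalAtlas 𝓘(𝕜, E) n M := by
  rw [IsManifold.mem_maximalAtlas_iff, _root_.mem_maximalAtlas_iff]
  intro c hc
  have hc := IsManifold.subset_maximalAtlas (I := 𝓘(𝕜, E)) (n := n) hc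
  have h1 := contMDiffOn_of_mem_maximalAtlas hc
  have h2 := contMDiffOn_symm_of_mem_maximalAtlas hc
  have h3 : ContDiffOn 𝕜 n (c ∘ e.symm) (e.symm ≫ₕ c).source :=
    contMDiffOn_iff_contDiffOn.1 (h1.comp (he'.mono fun x hx => hx.1) fun x hx => hx.2)
  have h4 : ContDiffOn 𝕜 n (e ∘ c.symm) (c.symm ≫ₕ e).source :=
    contMDiffOn_iff_contDiffOn.1 (he.comp (h2.mono fun x hx => hx.1) fun x hx => hx.2)
  have key : ∀ f : OpenPartialHomeomorph E E, ContDiffOn 𝕜 n f f.source →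
      ContDiffOn 𝕜 n f.symm f.target → f ∈ contDiffGroupoid n 𝓘(𝕜, E) := by
    intro f hf hf'
    rw [contDiffGroupoid, mem_groupoid_of_pregroupoid]
    exact ⟨by simpa [contDiffPregroupoid] using hf, by simpa [contDiffPregroupoid] using hf'⟩
  have e1 : (e.symm ≫ₕ c).target = (c.symm ≫ₕ e).source := by
    rw [← OpenPartialHomeomorph.symm_source, OpenPartialHomeomorph.trans_symm_eq_symm_trans_symm,
      OpenPartialHomeomorph.symm_symm]
  have e2 : (c.symm ≫ₕ e).target = (e.symm ≫ₕ c).source := by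
    rw [← OpenPartialHomeomorph.symm_source, OpenPartialHomeomorph.trans_symm_eq_symm_trans_symm,
      OpenPartialHomeomorph.symm_symm]
  exact ⟨key _ h3 (e1 ▸ h4), key _ h4 (e2 ▸ h3)⟩

variable (𝕜 V E M n) in
/-- An embedding `s` of `M` into a normed space `V`, with local `C^n` coordinate changes of `V` that
straighten the image of `s` to a complemented subspace `E`. -/
structure SliceAtlas where
  /-- the embedding -/
  emb : M → V
  isEmbedding : IsEmbedding emb
  /-- the inclusion of the model space -/
  incl : E →L[𝕜] V
  /-- the projection to the model space -/
  proj : V →L[𝕜] E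
  proj_incl : ∀ u, proj (incl u) = u
  /-- the coordinate change near a point -/
  chart : M → OpenPartialHomeomorph V V
  mem_source : ∀ m, emb m ∈ (chart m).source
  contDiffOn : ∀ m, ContDiffOn 𝕜 n (chart m) (chart m).source
  contDiffOn_symm : ∀ m, ContDiffOn 𝕜 n (chart m).symm (chart m).target
  mem_range_iff : ∀ m, ∀ a ∈ (chart m).source, a ∈ range emb ↔ chart m a ∈ range incl

namespace SliceAtlas

variable (S : SliceAtlas 𝕜 V E M n)

theorem incl_proj {m x : M} (hx : S.emb x ∈ (S.chart m).source) :
    S.incl (S.proj (S.chart m (S.emb x))) = S.chart m (S.emb x) := by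
  obtain ⟨u, hu⟩ := (S.mem_range_iff m _ hx).1 (mem_range_self x)
  rw [← hu, S.proj_incl]

theorem symm_incl_mem_range {m : M} {u : E} (hu : S.incl u ∈ (S.chart m).target) :
    (S.chart m).symm (S.incl u) ∈ range S.emb := by
  rw [S.mem_range_iff m _ ((S.chart m).map_target hu), (S.chart m).right_inv hu]
  exact mem_range_self u

/-- The point of `M` with coordinates `u` near `m`. -/
def point (m : M) (u : E) : M :=
  haveI : Nonempty M := ⟨m⟩
  Function.invFun S.emb ((S.chart m).symm (S.incl u))

theorem emb_point {m : M} {u : E} (hu : S.incl u ∈ (S.chart m).target) :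
    S.emb (S.point m u) = (S.chart m).symm (S.incl u) :=
  haveI : Nonempty M := ⟨m⟩
  Function.invFun_eq (S.symm_incl_mem_range hu)

/-- The chart of `M` near `m`. -/
def sliceChart (m : M) : OpenPartialHomeomorph M E where
  toFun x := S.proj (S.chart m (S.emb x))
  invFun := S.point m
  source := S.emb ⁻¹' (S.chart m).source
  target := S.incl ⁻¹' (S.chart m).target
  map_source' x hx := by
    rw [mem_preimage, S.incl_proj hx]
    exact (S.chart m).map_source hx
  map_target' u hu := by
    rw [mem_preimage, S.emb_point hu]
    exact (S.chart m).map_target hu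
  left_inv' x hx := by
    have h : S.incl (S.proj (S.chart m (S.emb x))) ∈ (S.chart m).target := by
      rw [S.incl_proj hx]; exact (S.chart m).map_source hx
    apply S.isEmbedding.injective
    rw [S.emb_point h, S.incl_proj hx, (S.chart m).left_inv hx]
  right_inv' u hu := by
    rw [S.emb_point hu, (S.chart m).right_inv hu, S.proj_incl]
  open_source := (S.chart m).open_source.preimage S.isEmbedding.continuous
  open_target := (S.chart m).open_target.preimage S.incl.continuous
  continuousOn_toFun := S.proj.continuous.comp_continuousOn
    ((S.chart m).continuousOn.comp S.isEmbedding.continuous.continuousOn fun _ hx => hx)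
  continuousOn_invFun := by
    rw [S.isEmbedding.continuousOn_iff]
    refine ContinuousOn.congr (f := (S.chart m).symm ∘ S.incl) ?_ fun u hu => S.emb_point hu
    exact (S.chart m).continuousOn_symm.comp S.incl.continuous.continuousOn fun _ hx => hx

/-- The manifold structure of `M` as an embedded submanifold of `V`. -/
@[reducible]
def chartedSpace : ChartedSpace E M where
  atlas := range S.sliceChart
  chartAt := S.sliceChart
  mem_chart_source := S.mem_source
  chart_mem_atlas := mem_range_self

/-- A change of slice coordinates is an ambient coordinate change, preceded by `incl` and followed
by `proj`. -/
theorem isManifold : letI := S.chartedSpace; IsManifold 𝓘(𝕜, E) n M := by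
  let := S.chartedSpace
  apply isManifold_of_contDiffOn
  rintro _ _ ⟨m, rfl⟩ ⟨m', rfl⟩
  have hs : 𝓘(𝕜, E).symm ⁻¹' ((S.sliceChart m).symm ≫ₕ S.sliceChart m').source ∩
      range 𝓘(𝕜, E) = ((S.sliceChart m).symm ≫ₕ S.sliceChart m').source := by
    simp
  rw [hs]
  refine ContDiffOn.congr
    (f := S.proj ∘ S.chart m' ∘ (S.chart m).symm ∘ S.incl) ?_ fun u hu => ?_
  · refine S.proj.contDiff.comp_contDiffOn ((S.contDiffOn m').comp
      ((S.contDiffOn_symm m).comp S.incl.contDiff.contDiffOn fun u hu => hu.1) fun u hu => ?_)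
    have h2 : S.emb (S.point m u) ∈ (S.chart m').source := hu.2
    rwa [S.emb_point hu.1] at h2
  · change S.proj (S.chart m' (S.emb (S.point m u))) = _
    rw [S.emb_point hu.1]
    rfl

/-- The splitting of `V` along the model space. -/
def splitting : (E × S.proj.ker) ≃L[𝕜] V :=
  (ContinuousLinearEquiv.equivOfRightInverse S.proj S.incl S.proj_incl).symm

theorem chart_mem_maximalAtlas (m : M) :
    S.chart m ∈ IsManifold.maximalAtlas 𝓘(𝕜, V) n V :=
  IsManifold.mem_maximalAtlas_of_contMDiffOn (contMDiffOn_iff_contDiffOn.2 (S.contDiffOn m))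
    (contMDiffOn_iff_contDiffOn.2 (S.contDiffOn_symm m))

/-- Read in the slice chart and the ambient chart at `m`, the embedding is `incl`, which the
splitting identifies with `u ↦ (u, 0)`. -/
theorem isImmersion : letI := S.chartedSpace; IsImmersion 𝓘(𝕜, E) 𝓘(𝕜, V) n S.emb := by
  let := S.chartedSpace
  have := S.isManifold
  refine IsImmersionOfComplement.isImmersion (F := S.proj.ker) fun m => ?_
  refine IsImmersionAtOfComplement.mk_of_charts S.splitting (S.sliceChart m) (S.chart m)
    (S.mem_source m) (S.mem_source m) (IsManifold.chart_mem_maximalAtlas m)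
    (S.chart_mem_maximalAtlas m) subset_rfl ?_
  intro u hu
  have hu' : S.incl u ∈ (S.chart m).target := by
    have h : u ∈ (S.sliceChart m).target := by simpa using hu
    exact h
  change S.chart m (S.emb (S.point m u)) = S.splitting (u, 0)
  rw [S.emb_point hu', (S.chart m).right_inv hu', splitting,
    ContinuousLinearEquiv.equivOfRightInverse_symm_apply]
  simp

theorem isSmoothEmbedding :
    let := S.chartedSpace; IsSmoothEmbedding 𝓘(𝕜, E) 𝓘(𝕜, V) n S.emb :=
  let := S.chartedSpace
  ⟨S.isImmersion, S.isEmbedding⟩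

/-- The slice charts belong to every manifold structure for which the embedding is an immersion. -/
theorem sliceChart_mem_maximalAtlas [ChartedSpace E M] [IsManifold 𝓘(𝕜, E) n M]
    (h : IsImmersion 𝓘(𝕜, E) 𝓘(𝕜, V) n S.emb) (m : M) :
    S.sliceChart m ∈ IsManifold.maximalAtlas 𝓘(𝕜, E) n M := by
  refine IsManifold.mem_maximalAtlas_of_contMDiffOn ?_ fun u hu => ?_
  · exact (S.proj.contDiff.contMDiff.comp_contMDiffOn (contMDiffOn_iff_contDiffOn.2
      (S.contDiffOn m))).comp h.contMDiff.contMDiffOn fun x hx => hx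
  · refine ContMDiffAt.contMDiffWithinAt ?_
    -- Regularity of the inverse chart for the given structure is tested after composing with the
    -- immersion, where it becomes that of `(S.chart m).symm ∘ S.incl`.
    rw [ContMDiffAt.iff_comp_isImmersionAt (h.isImmersionAt _)]
    have ho := (S.sliceChart m).open_target.mem_nhds hu
    refine ⟨(S.sliceChart m).continuousOn_symm.continuousAt ho, ?_⟩
    refine ContMDiffOn.contMDiffAt ?_ ho
    refine ContMDiffOn.congr (f := (S.chart m).symm ∘ S.incl) ?_ fun v hv => S.emb_point hv
    exact (contMDiffOn_iff_contDiffOn.2 (S.contDiffOn_symm m)).comp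
      S.incl.contDiff.contMDiff.contMDiffOn fun v hv => hv

/-- A map between slices that is linear in the coordinates is an embedding. -/
theorem isSmoothEmbedding_map (T : SliceAtlas 𝕜 V F K n) [ChartedSpace E M]
    [IsManifold 𝓘(𝕜, E) n M] (h : IsImmersion 𝓘(𝕜, E) 𝓘(𝕜, V) n S.emb)
    {f : K → M} (hf : ∀ k, S.emb (f k) = T.emb k) (j : F →L[𝕜] E) (q : E →L[𝕜] F)
    (hqj : ∀ u, q (j u) = u) (hj : ∀ u, S.incl (j u) = T.incl u)
    (hc : ∀ k, S.chart (f k) = T.chart k) :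
    let := T.chartedSpace; IsSmoothEmbedding 𝓘(𝕜, F) 𝓘(𝕜, E) n f := by
  let := T.chartedSpace
  have := T.isManifold
  have hemb : IsEmbedding f := by
    have : IsEmbedding (S.emb ∘ f) := by
      convert! T.isEmbedding using 1
      exact funext hf
    exact (S.isEmbedding.of_comp_iff).1 this
  refine ⟨IsImmersionOfComplement.isImmersion (F := q.ker) fun k => ?_, hemb⟩
  refine IsImmersionAtOfComplement.mk_of_charts
    (ContinuousLinearEquiv.equivOfRightInverse q j hqj).symm (T.sliceChart k) (S.sliceChart (f k))
    (T.mem_source k) (S.mem_source (f k)) (IsManifold.chart_mem_maximalAtlas k)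
    (S.sliceChart_mem_maximalAtlas h (f k)) (fun x hx => ?_) ?_
  · change S.emb (f x) ∈ (S.chart (f k)).source
    rw [hf, hc]
    exact hx
  · intro u hu
    have hu' : T.incl u ∈ (T.chart k).target := by
      have h : u ∈ (T.sliceChart k).target := by simpa using hu
      exact h
    change S.proj (S.chart (f k) (S.emb (f (T.point k u)))) = _
    -- Since the ambient charts agree, they cancel and `f` reads as `j`.
    rw [hf, hc, T.emb_point hu', (T.chart k).right_inv hu', ← hj, S.proj_incl, Function.comp_apply,
      ContinuousLinearEquiv.equivOfRightInverse_symm_apply]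
    simp

end SliceAtlas

/-- A group structure on an embedded submanifold is a Lie group if multiplication and inversion
are `C^n` as maps to the ambient space. -/
theorem LieGroup.of_isSmoothEmbedding [Group M] [ChartedSpace E M] [IsManifold 𝓘(𝕜, E) n M]
    {s : M → V} (hs : IsSmoothEmbedding 𝓘(𝕜, E) 𝓘(𝕜, V) n s)
    (hmul : ContMDiff (𝓘(𝕜, E).prod 𝓘(𝕜, E)) 𝓘(𝕜, V) n fun x : M × M => s (x.1 * x.2))
    (hinv : ContMDiff 𝓘(𝕜, E) 𝓘(𝕜, V) n fun x : M => s x⁻¹) :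
    LieGroup 𝓘(𝕜, E) n M where
  contMDiff_mul := (ContMDiff.iff_comp_isImmersion hs.isImmersion).2
    ⟨hs.isEmbedding.continuous_iff.2 hmul.continuous, hmul⟩
  contMDiff_inv := (ContMDiff.iff_comp_isImmersion hs.isImmersion).2
    ⟨hs.isEmbedding.continuous_iff.2 hinv.continuous, hinv⟩

end Slices

noncomputable section

namespace RestrictedSymplectic

open Set Topology Manifold

variable {H : Type*} [NormedAddCommGroup H] [InnerProductSpace ℝ H] [CompleteSpace H]

/-! ### The Banach space `B₂(H)` and its products with bounded operators -/

namespace HilbertSchmidt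

theorem toOp_injective : Function.Injective (toOp H) := Subtype.val_injective

theorem isHilbertSchmidt_toOp (a : HilbertSchmidt H) : IsHilbertSchmidt (toOp H a) := a.2

/-- A bounded operator that is Hilbert-Schmidt, as an element of `B₂(H)`. -/
def ofOp (c : H →L[ℝ] H) (hc : IsHilbertSchmidt c) : HilbertSchmidt H := ⟨c, hc⟩

@[simp]
theorem toOp_ofOp (c : H →L[ℝ] H) (hc : IsHilbertSchmidt c) : toOp H (ofOp c hc) = c := rfl

theorem norm_le_of_sq_le {a : HilbertSchmidt H} {r : ℝ} (hr : 0 ≤ r)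
    (h : ∑' i, ‖toOp H a (basis H i)‖ ^ 2 ≤ r ^ 2) : ‖a‖ ≤ r := by
  rw [← norm_sq_eq H (basis H)] at h
  exact (pow_le_pow_iff_left₀ (norm_nonneg _) hr two_ne_zero).1 h

/-- Left multiplication of a Hilbert-Schmidt operator by a bounded operator. -/
def lmul : (H →L[ℝ] H) →L[ℝ] HilbertSchmidt H →L[ℝ] HilbertSchmidt H :=
  LinearMap.mkContinuous₂
    (LinearMap.mk₂ ℝ
      (fun c a => ofOp (c * toOp H a) ((isHilbertSchmidt_toOp a).mul_left c))
      (fun _ _ _ => toOp_injective (add_mul _ _ _))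
      (fun _ _ _ => toOp_injective (smul_mul_assoc _ _ _))
      (fun _ _ _ => toOp_injective (mul_add _ _ _))
      (fun _ _ _ => toOp_injective (mul_smul_comm _ _ _)))
    1 fun c a => by
      rw [one_mul]
      refine norm_le_of_sq_le (by positivity) ?_
      rw [mul_pow, norm_sq_eq H (basis H), ← tsum_mul_left]
      refine Summable.tsum_le_tsum (fun i => ?_) ((isHilbertSchmidt_toOp a).mul_left c)
        (Summable.mul_left _ (isHilbertSchmidt_toOp a))
      rw [← mul_pow]
      gcongr
      exact c.le_opNorm _

@[simp]
theorem toOp_lmul (c : H →L[ℝ] H) (a : HilbertSchmidt H) : toOp H (lmul c a) = c * toOp H a := rfl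

theorem norm_adjoint_eq (a b : HilbertSchmidt H)
    (h : toOp H b = ContinuousLinearMap.adjoint (toOp H a)) : ‖b‖ = ‖a‖ := by
  have key : ∀ x : HilbertSchmidt H,
      ‖x‖ ^ 2 = (∑' i, ‖toOp H x (basis H i)‖ₑ ^ 2).toReal := fun x => by
    rw [norm_sq_eq H (basis H), ENNReal.tsum_toReal_eq (fun i => by finiteness)]
    simp
  have e : ‖b‖ ^ 2 = ‖a‖ ^ 2 := by
    rw [key, key, tsum_enorm_adjoint (basis H) (basis H) (toOp H a), h]
  exact (sq_eq_sq₀ (norm_nonneg _) (norm_nonneg _)).1 e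

/-- The adjoint of a Hilbert-Schmidt operator. -/
def adj : HilbertSchmidt H →L[ℝ] HilbertSchmidt H :=
  LinearMap.mkContinuous
    { toFun := fun a => ofOp (ContinuousLinearMap.adjoint (toOp H a))
        (isHilbertSchmidt_toOp a).adjoint
      map_add' := fun a b => toOp_injective (by simp)
      map_smul' := fun r a => toOp_injective (by simp) }
    1 fun a => by
      rw [one_mul]
      exact (norm_adjoint_eq a _ rfl).le

@[simp]
theorem toOp_adj (a : HilbertSchmidt H) :
    toOp H (adj a) = ContinuousLinearMap.adjoint (toOp H a) := rfl

/-- Right multiplication of a Hilbert-Schmidt operator by a bounded operator. -/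
def rmul (c : H →L[ℝ] H) : HilbertSchmidt H →L[ℝ] HilbertSchmidt H :=
  adj ∘L lmul (ContinuousLinearMap.adjoint c) ∘L adj

@[simp]
theorem toOp_rmul (c : H →L[ℝ] H) (a : HilbertSchmidt H) :
    toOp H (rmul c a) = toOp H a * c := by
  simp [rmul, ← ContinuousLinearMap.star_eq_adjoint]

/-- Parseval for the adjoint: `‖a* y‖² = ∑ ⟪a eᵢ, y⟫² ≤ (∑ ‖a eᵢ‖²) ‖y‖²`. -/
theorem norm_toOp_le (a : HilbertSchmidt H) : ‖toOp H a‖ ≤ ‖a‖ := by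
  rw [← LinearIsometryEquiv.norm_map ContinuousLinearMap.adjoint (toOp H a)]
  refine ContinuousLinearMap.opNorm_le_bound _ (norm_nonneg _) fun y => ?_
  refine (pow_le_pow_iff_left₀ (norm_nonneg _) (by positivity) two_ne_zero).1 ?_
  have hs := (basis H).hasSum_inner_mul_inner (ContinuousLinearMap.adjoint (toOp H a) y)
    (ContinuousLinearMap.adjoint (toOp H a) y)
  rw [← real_inner_self_eq_norm_sq, ← hs.tsum_eq, mul_pow, norm_sq_eq H (basis H), ← tsum_mul_right]
  refine Summable.tsum_le_tsum (fun i => ?_) hs.summable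
    (Summable.mul_right _ (isHilbertSchmidt_toOp a))
  rw [real_inner_comm, ← sq, ContinuousLinearMap.adjoint_inner_right, ← mul_pow, ← sq_abs]
  gcongr
  exact abs_real_inner_le_norm _ _

/-- The inclusion of the Hilbert-Schmidt operators in the bounded operators. -/
def toOpL : HilbertSchmidt H →L[ℝ] H →L[ℝ] H :=
  LinearMap.mkContinuous (toOp H) 1 fun a => by
    rw [one_mul]; exact norm_toOp_le a

theorem isometry_toLp : Isometry (toLp H) :=
  AddMonoidHomClass.isometry_of_norm (toLp H) fun _ => rfl

/-- A Cauchy sequence converges in `ℓ²` through `toLp`, and also in operator norm. The two limits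
agree on the basis, so the `ℓ²` limit comes from a bounded operator. -/
instance : CompleteSpace (HilbertSchmidt H) := by
  refine Metric.complete_of_cauchySeq_tendsto fun u hu => ?_
  obtain ⟨f, hf⟩ := cauchySeq_tendsto_of_complete (isometry_toLp.uniformContinuous.comp_cauchySeq hu)
  obtain ⟨c, hc⟩ := cauchySeq_tendsto_of_complete
    ((toOpL (H := H)).uniformContinuous.comp_cauchySeq hu)
  have hcf : ∀ i, c (basis H i) = f i := fun i => by
    refine tendsto_nhds_unique (f := fun n => toOp H (u n) (basis H i))
      (l := Filter.atTop) ?_ ?_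
    · exact ((ContinuousLinearMap.apply ℝ H (basis H i)).continuous.tendsto c).comp hc
    · exact ((lp.evalCLM ℝ (fun _ : basisIndex H => H) 2 i).continuous.tendsto f).comp hf
  have hc2 : IsHilbertSchmidt c := by
    rw [isHilbertSchmidt_iff_memℓp]
    simp_rw [hcf]
    exact f.2
  refine ⟨ofOp c hc2, ?_⟩
  rw [(isometry_toLp (H := H)).isEmbedding.tendsto_nhds_iff]
  convert! hf using 2
  exact lp.ext (funext hcf)

end HilbertSchmidt

/-! ### Algebra of the Cayley transform in a ring -/

section CayleyAlgebra

variable {A : Type*} [Ring A] {a y : A}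

theorem isUnit_of_mul_eq_isUnit {u v w : A} (hu : IsUnit u) (hw : IsUnit w)
    (h : u * v = w) : IsUnit v := by
  obtain ⟨u, rfl⟩ := hu
  rwa [← h, Units.isUnit_units_mul] at hw

/-- The relation `(2 + a) * y = a` encodes `y = (2 + a)⁻¹ a` without an inverse; the inverse
transform is encoded by `(1 - y) * a = y + y`. -/
theorem cayley_mul_one_sub (hy : (2 + a) * y = a) : (2 + a) * (1 - y) = 2 := by
  rw [mul_sub, hy]; noncomm_ring

theorem cayley_mul_one_add (hy : (2 + a) * y = a) : (2 + a) * (1 + y) = 2 * (1 + a) := by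
  rw [mul_add, hy, ← one_add_one_eq_two]; noncomm_ring

theorem cayley_one_add_mul_one_sub (hy : (2 + a) * y = a) : (1 + a) * (1 - y) = 1 + y := by
  have h : (1 + a) * (1 - y) = (2 + a) * (1 - y) - (1 - y) := by
    rw [← one_add_one_eq_two]; noncomm_ring
  rw [h, cayley_mul_one_sub hy, ← one_add_one_eq_two]
  abel

theorem one_sub_mul_two_add (ha : (1 - y) * a = y + y) : (1 - y) * (2 + a) = 2 := by
  rw [mul_add, ha, ← one_add_one_eq_two]; noncomm_ring

theorem isUnit_one_add_of_one_sub (hu : IsUnit (1 - y)) (hu' : IsUnit (1 + y))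
    (ha : (1 - y) * a = y + y) : IsUnit (1 + a) := by
  refine isUnit_of_mul_eq_isUnit hu hu' ?_
  rw [mul_add, ha]; noncomm_ring

theorem one_sub_mul_of_cayley (hu : IsUnit (2 + a)) (hy : (2 + a) * y = a) :
    (1 - y) * a = y + y := by
  refine hu.mul_left_cancel ?_
  rw [← mul_assoc, cayley_mul_one_sub hy, mul_add, hy, two_mul]

theorem cayley_of_one_sub (hu : IsUnit (1 - y)) (ha : (1 - y) * a = y + y) : (2 + a) * y = a := by
  refine hu.mul_left_cancel ?_
  rw [← mul_assoc, one_sub_mul_two_add ha, ha, two_mul]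

variable [Algebra ℝ A]

variable (A) in
theorem isUnit_two_of_algebra_real : IsUnit (2 : A) := by
  have h := (IsUnit.mk0 (2 : ℝ) two_ne_zero).map (algebraMap ℝ A)
  rwa [map_ofNat] at h

theorem add_self_eq_zero_iff_of_algebra_real {x : A} : x + x = 0 ↔ x = 0 := by
  rw [← two_mul, (isUnit_two_of_algebra_real A).mul_right_eq_zero]

theorem isUnit_one_sub_of_cayley (hu : IsUnit (2 + a)) (hy : (2 + a) * y = a) : IsUnit (1 - y) :=
  isUnit_of_mul_eq_isUnit hu (isUnit_two_of_algebra_real A) (cayley_mul_one_sub hy)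

theorem isUnit_one_add_of_cayley (hu : IsUnit (2 + a)) (hu' : IsUnit (1 + a))
    (hy : (2 + a) * y = a) : IsUnit (1 + y) :=
  isUnit_of_mul_eq_isUnit hu ((isUnit_two_of_algebra_real A).mul hu') (cayley_mul_one_add hy)

theorem isUnit_two_add_of_one_sub (hu : IsUnit (1 - y)) (ha : (1 - y) * a = y + y) :
    IsUnit (2 + a) :=
  isUnit_of_mul_eq_isUnit hu (isUnit_two_of_algebra_real A) (one_sub_mul_two_add ha)

/-- The Cayley transform turns the invariance of a form into the infinitesimal invariance. -/
theorem cayley_form_iff [StarRing A] (hu : IsUnit (2 + a)) (hy : (2 + a) * y = a) (b : A) :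
    star (1 + a) * b * (1 + a) = b ↔ star y * b + b * y = 0 := by
  have hv := isUnit_one_sub_of_cayley hu hy
  have h := cayley_one_add_mul_one_sub hy
  -- Multiplying by the units `star (1 - y)` and `1 - y` turns the invariance into `(1 + y)* b (1 +
  -- y) = (1 - y)* b (1 - y)`, whose two sides differ by `2 (y* b + b y)`.
  have e : star (1 - y) * (star (1 + a) * b * (1 + a)) * (1 - y) =
      star (1 + y) * b * (1 + y) := by
    rw [← h, star_mul]; simp only [mul_assoc]
  rw [← hv.mul_left_inj, ← (hv.star).mul_right_inj, ← mul_assoc, e, ← mul_assoc, ← sub_eq_zero,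
    ← add_self_eq_zero_iff_of_algebra_real (x := star y * b + b * y)]
  refine Eq.congr ?_ rfl
  simp only [star_add, star_sub, star_one]
  noncomm_ring

/-- Each of `a` and `y` solves a linear equation with a unit coefficient built from the other, so
cancelling that unit transfers commutation. -/
theorem cayley_commute_iff (hu : IsUnit (2 + a)) (hy : (2 + a) * y = a) (b : A) :
    Commute a b ↔ Commute y b := by
  have hv := isUnit_one_sub_of_cayley hu hy
  have h2 : ∀ c : A, Commute 2 c := fun c => Commute.ofNat_left 2 c
  constructor
  · intro h
    refine hu.mul_left_cancel ?_
    have h' : Commute (2 + a) b := (h2 b).add_left h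
    rw [← mul_assoc, hy, ← mul_assoc, h'.eq, mul_assoc, hy, h.eq]
  · intro h
    refine hv.mul_left_cancel ?_
    have h' : Commute (1 - y) b := (Commute.one_left b).sub_left h
    have ha := one_sub_mul_of_cayley hu hy
    rw [← mul_assoc, ha, ← mul_assoc, h'.eq, mul_assoc, ha]
    exact (h.add_left h).eq

end CayleyAlgebra

open HilbertSchmidt

/-! ### The group `GL₂(H)` in the coordinate `g - 1` -/

@[simp]
theorem GL2.toOp_subOne (g : GL2 H) : HilbertSchmidt.toOp H g.subOne = g.toOp - 1 := rfl

theorem GL2.one_add_toOp_subOne (g : GL2 H) : 1 + HilbertSchmidt.toOp H g.subOne = g.toOp := by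
  simp

@[simp]
theorem GL2.toOp_mul (g h : GL2 H) : (g * h).toOp = g.toOp * h.toOp := rfl

@[simp]
theorem GL2.toOp_one : (1 : GL2 H).toOp = 1 := rfl

theorem GL2.toOp_mul_inv (g : GL2 H) : g.toOp * (g⁻¹).toOp = 1 := Units.mul_inv g.1

theorem GL2.toOp_inv_mul (g : GL2 H) : (g⁻¹).toOp * g.toOp = 1 := Units.inv_mul g.1

theorem GL2.isUnit_toOp (g : GL2 H) : IsUnit g.toOp := g.1.isUnit

theorem GL2.exists_subOne_eq {a : HilbertSchmidt H} (ha : IsUnit (1 + HilbertSchmidt.toOp H a)) :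
    ∃ g : GL2 H, g.subOne = a := by
  obtain ⟨u, hu⟩ := ha
  have h : (u : H →L[ℝ] H) - 1 = HilbertSchmidt.toOp H a := by rw [hu]; simp
  exact ⟨⟨u, by
    change IsHilbertSchmidt ((u : H →L[ℝ] H) - 1)
    rw [h]; exact isHilbertSchmidt_toOp a⟩, toOp_injective h⟩

theorem GL2.isEmbedding_subOne : IsEmbedding (GL2.subOne (H := H)) :=
  (MetricSpace.isometry_induced GL2.subOne GL2.subOne_injective).isEmbedding

/-- Together with `GL2.subOne_inv`, this writes the group operations as analytic expressions in `g -
1`. -/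
theorem GL2.subOne_mul (g h : GL2 H) :
    (g * h).subOne = g.subOne + h.subOne + lmul (HilbertSchmidt.toOp H g.subOne) h.subOne := by
  apply toOp_injective
  simp
  noncomm_ring

theorem GL2.subOne_inv (g : GL2 H) :
    (g⁻¹).subOne = -lmul (Ring.inverse (1 + HilbertSchmidt.toOp H g.subOne)) g.subOne := by
  apply toOp_injective
  have e : Ring.inverse g.toOp = (g⁻¹).toOp := Ring.inverse_unit g.1
  rw [map_neg, toOp_lmul, one_add_toOp_subOne, e, toOp_subOne, toOp_subOne, mul_sub,
    toOp_inv_mul]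
  noncomm_ring

/-- Left translation by `g` on the affine space `1 + B₂(H)`. -/
def translate (g : GL2 H) : HilbertSchmidt H ≃ₜ HilbertSchmidt H where
  toFun a := lmul g.toOp a + g.subOne
  invFun a := lmul (g⁻¹).toOp a + (g⁻¹).subOne
  left_inv a := toOp_injective (by
    simp only [map_add, toOp_lmul, GL2.toOp_subOne, ← mul_assoc, mul_sub,
      GL2.toOp_inv_mul]
    noncomm_ring)
  right_inv a := toOp_injective (by
    simp only [map_add, toOp_lmul, GL2.toOp_subOne, ← mul_assoc, mul_sub,
      GL2.toOp_mul_inv]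
    noncomm_ring)
  continuous_toFun := by fun_prop
  continuous_invFun := by fun_prop

theorem translate_apply (g : GL2 H) (a : HilbertSchmidt H) :
    translate g a = lmul g.toOp a + g.subOne := rfl

theorem translate_symm (g : GL2 H) : (translate g).symm = translate g⁻¹ := rfl

theorem translate_subOne (g h : GL2 H) : translate g h.subOne = (g * h).subOne := by
  apply toOp_injective
  simp [translate_apply, mul_sub]

theorem contDiff_translate (g : GL2 H) : ContDiff ℝ ω (translate g) :=
  (lmul g.toOp).contDiff.add contDiff_const

/-- Inversion is analytic for the operator norm; the bounded bilinear map `lmul` brings the result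
back to the Hilbert-Schmidt norm. -/
theorem contDiffOn_lmul_inverse {f : HilbertSchmidt H → H →L[ℝ] H} (hf : ContDiff ℝ ω f)
    {s : Set (HilbertSchmidt H)} (hs : ∀ a ∈ s, IsUnit (f a)) :
    ContDiffOn ℝ ω (fun a => lmul (Ring.inverse (f a)) a) s := by
  intro a ha
  obtain ⟨u, hu⟩ := hs a ha
  have h1 : ContDiffAt ℝ ω (fun a => Ring.inverse (f a)) a :=
    ContDiffAt.comp (g := Ring.inverse) a (hu ▸ contDiffAt_ringInverse ℝ u) hf.contDiffAt
  exact ((lmul.contDiff.contDiffAt.comp a h1).clm_apply contDiffAt_id).contDiffWithinAt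

theorem contDiff_add_toOp (c : H →L[ℝ] H) : ContDiff ℝ ω fun a => c + HilbertSchmidt.toOp H a :=
  contDiff_const.add (toOpL (H := H)).contDiff

theorem contDiff_sub_toOp (c : H →L[ℝ] H) : ContDiff ℝ ω fun a => c - HilbertSchmidt.toOp H a :=
  contDiff_const.sub (toOpL (H := H)).contDiff

theorem isOpen_isUnit_comp {f : HilbertSchmidt H → H →L[ℝ] H} (hf : ContDiff ℝ ω f) :
    IsOpen {a | IsUnit (f a)} :=
  Units.isOpen.preimage hf.continuous

/-! ### The Cayley transform as an analytic chart of `B₂(H)` -/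

/-- The formula of the Cayley transform. -/
def cayleyFun (a : HilbertSchmidt H) : HilbertSchmidt H :=
  lmul (Ring.inverse (2 + HilbertSchmidt.toOp H a)) a

/-- The formula of the inverse Cayley transform. -/
def cayleyInv (y : HilbertSchmidt H) : HilbertSchmidt H :=
  (2 : ℝ) • lmul (Ring.inverse (1 - HilbertSchmidt.toOp H y)) y

theorem contDiffOn_cayleyFun : ContDiffOn ℝ ω (cayleyFun (H := H))
    {a | IsUnit (2 + HilbertSchmidt.toOp H a)} :=
  contDiffOn_lmul_inverse (contDiff_add_toOp 2) fun _ h => h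

theorem contDiffOn_cayleyInv : ContDiffOn ℝ ω (cayleyInv (H := H))
    {y | IsUnit (1 - HilbertSchmidt.toOp H y)} :=
  (contDiffOn_lmul_inverse (contDiff_sub_toOp 1) fun _ h => h).const_smul (2 : ℝ)

theorem toOp_cayleyFun {a : HilbertSchmidt H} (ha : IsUnit (2 + HilbertSchmidt.toOp H a)) :
    (2 + HilbertSchmidt.toOp H a) * HilbertSchmidt.toOp H (cayleyFun a) =
      HilbertSchmidt.toOp H a :=
  Ring.mul_inverse_cancel_left _ _ ha

theorem toOp_cayleyInv {y : HilbertSchmidt H} (hy : IsUnit (1 - HilbertSchmidt.toOp H y)) :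
    (1 - HilbertSchmidt.toOp H y) * HilbertSchmidt.toOp H (cayleyInv y) =
      HilbertSchmidt.toOp H y + HilbertSchmidt.toOp H y := by
  rw [cayleyInv, map_smul, toOp_lmul, mul_smul_comm, Ring.mul_inverse_cancel_left _ _ hy, two_smul]

/-- The Cayley transform `1 + a ↦ a (2 + a)⁻¹`. -/
def cayley : OpenPartialHomeomorph (HilbertSchmidt H) (HilbertSchmidt H) where
  toFun := cayleyFun
  invFun := cayleyInv
  -- The formulas invert each other without the second condition; it restricts the chart to points
  -- `g - 1` with `g` in `GL₂(H)`.
  source := {a | IsUnit (2 + HilbertSchmidt.toOp H a)} ∩ {a | IsUnit (1 + HilbertSchmidt.toOp H a)}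
  target := {y | IsUnit (1 - HilbertSchmidt.toOp H y)} ∩ {y | IsUnit (1 + HilbertSchmidt.toOp H y)}
  map_source' _ h := ⟨isUnit_one_sub_of_cayley h.1 (toOp_cayleyFun h.1),
    isUnit_one_add_of_cayley h.1 h.2 (toOp_cayleyFun h.1)⟩
  map_target' _ h := ⟨isUnit_two_add_of_one_sub h.1 (toOp_cayleyInv h.1),
    isUnit_one_add_of_one_sub h.1 h.2 (toOp_cayleyInv h.1)⟩
  left_inv' a h := by
    have hv := isUnit_one_sub_of_cayley h.1 (toOp_cayleyFun h.1)
    refine toOp_injective (hv.mul_left_cancel ?_)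
    rw [toOp_cayleyInv hv, one_sub_mul_of_cayley h.1 (toOp_cayleyFun h.1)]
  right_inv' y h := by
    have hv := isUnit_two_add_of_one_sub h.1 (toOp_cayleyInv h.1)
    refine toOp_injective (hv.mul_left_cancel ?_)
    rw [toOp_cayleyFun hv, cayley_of_one_sub h.1 (toOp_cayleyInv h.1)]
  open_source := (isOpen_isUnit_comp (contDiff_add_toOp 2)).inter
    (isOpen_isUnit_comp (contDiff_add_toOp 1))
  open_target := (isOpen_isUnit_comp (contDiff_sub_toOp 1)).inter
    (isOpen_isUnit_comp (contDiff_add_toOp 1))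
  continuousOn_toFun := contDiffOn_cayleyFun.continuousOn.mono inter_subset_left
  continuousOn_invFun := contDiffOn_cayleyInv.continuousOn.mono inter_subset_left

theorem mem_cayley_source {a : HilbertSchmidt H} : a ∈ (cayley (H := H)).source ↔
    IsUnit (2 + HilbertSchmidt.toOp H a) ∧ IsUnit (1 + HilbertSchmidt.toOp H a) := Iff.rfl

theorem two_add_mul_cayley {a : HilbertSchmidt H} (h : a ∈ (cayley (H := H)).source) :
    (2 + HilbertSchmidt.toOp H a) * HilbertSchmidt.toOp H (cayley a) = HilbertSchmidt.toOp H a :=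
  toOp_cayleyFun h.1

theorem contDiffOn_cayley : ContDiffOn ℝ ω (cayley (H := H)) (cayley (H := H)).source :=
  contDiffOn_cayleyFun.mono inter_subset_left

theorem contDiffOn_cayley_symm :
    ContDiffOn ℝ ω (cayley (H := H)).symm (cayley (H := H)).target :=
  contDiffOn_cayleyInv.mono inter_subset_left

/-! ### Lie groups from Cayley slices -/

/-- A subgroup of `GL₂(H)` that the Cayley transform maps to a complemented subspace is an embedded
submanifold. -/
def cayleySlices {G : Type*} [Group G] [TopologicalSpace G] (ι : G →* GL2 H) (hι : IsEmbedding ι)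
    (E : Submodule ℝ (HilbertSchmidt H)) (P : HilbertSchmidt H →L[ℝ] E) (hP : ∀ u : E, P u = u)
    (hE : ∀ g : GL2 H, g.subOne ∈ (cayley (H := H)).source →
      (g ∈ range ι ↔ cayley g.subOne ∈ E)) :
    SliceAtlas ℝ (HilbertSchmidt H) E G ω where
  emb g := (ι g).subOne
  isEmbedding := GL2.isEmbedding_subOne.comp hι
  incl := E.subtypeL
  proj := P
  proj_incl := hP
  chart g := (translate (ι g)⁻¹).toOpenPartialHomeomorph ≫ₕ cayley
  mem_source g := by
    refine ⟨mem_univ _, ?_⟩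
    change translate (ι g)⁻¹ (ι g).subOne ∈ (cayley (H := H)).source
    rw [translate_subOne, inv_mul_cancel, mem_cayley_source]
    simp [isUnit_two_of_algebra_real]
  contDiffOn g := contDiffOn_cayley.comp (contDiff_translate _).contDiffOn fun _ h => h.2
  contDiffOn_symm g := (contDiff_translate ((ι g)⁻¹)⁻¹).comp_contDiffOn
    (contDiffOn_cayley_symm.mono fun _ h => h.1)
  mem_range_iff g a ha := by
    have ha' : translate (ι g)⁻¹ a ∈ (cayley (H := H)).source := ha.2
    -- The point is `ι g * h` with `h` in the Cayley domain; as the range of `ι` is a subgroup, `ι g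
    -- * h` lies in it exactly when `h` does.
    obtain ⟨h, hh⟩ := GL2.exists_subOne_eq ha'.2
    have e : a = (ι g * h).subOne := by
      rw [← translate_subOne, hh, ← translate_symm, Homeomorph.apply_symm_apply]
    change _ ↔ cayley (translate (ι g)⁻¹ a) ∈ range E.subtypeL
    rw [← hh] at ha' ⊢
    have hr : cayley h.subOne ∈ range E.subtypeL ↔ cayley h.subOne ∈ E := by simp
    rw [hr, ← hE h ha', e]
    constructor
    · rintro ⟨x, hx⟩
      exact ⟨g⁻¹ * x, by rw [map_mul, map_inv, GL2.subOne_injective hx, inv_mul_cancel_left]⟩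
    · rintro ⟨x, rfl⟩
      exact ⟨g * x, congrArg GL2.subOne (map_mul ι g x)⟩

/-- A group that is an embedded submanifold of `1 + B₂(H)` through a homomorphism to `GL₂(H)` is a
Lie group. -/
theorem lieGroup_of_isSmoothEmbedding {E : Type*} [NormedAddCommGroup E] [NormedSpace ℝ E]
    {G : Type*} [Group G] [TopologicalSpace G] [ChartedSpace E G] [IsManifold 𝓘(ℝ, E) ω G]
    (ι : G →* GL2 H)
    (hs : IsSmoothEmbedding 𝓘(ℝ, E) 𝓘(ℝ, HilbertSchmidt H) ω fun g => (ι g).subOne) :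
    LieGroup 𝓘(ℝ, E) ω G := by
  have hc := hs.contMDiff
  refine LieGroup.of_isSmoothEmbedding hs ?_ ?_
  · simp_rw [map_mul, GL2.subOne_mul]
    have h1 := hc.comp (contMDiff_fst (I := 𝓘(ℝ, E)) (J := 𝓘(ℝ, E)) (M := G) (N := G))
    have h2 := hc.comp (contMDiff_snd (I := 𝓘(ℝ, E)) (J := 𝓘(ℝ, E)) (M := G) (N := G))
    have h3 : ContMDiff (𝓘(ℝ, E).prod 𝓘(ℝ, E)) 𝓘(ℝ, HilbertSchmidt H →L[ℝ] HilbertSchmidt H) ω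
        fun x : G × G => lmul (toOpL (ι x.1).subOne) :=
      (lmul ∘L toOpL (H := H)).contDiff.contMDiff.comp h1
    exact (h1.add h2).add (h3.clm_apply h2)
  · simp_rw [map_inv, GL2.subOne_inv]
    have hi : ContDiffOn ℝ ω (fun a : HilbertSchmidt H =>
        -lmul (Ring.inverse (1 + HilbertSchmidt.toOp H a)) a)
        {a | IsUnit (1 + HilbertSchmidt.toOp H a)} :=
      (contDiffOn_lmul_inverse (contDiff_add_toOp 1) fun _ h => h).neg
    refine (contMDiffOn_iff_contDiffOn.2 hi).comp_contMDiff hc fun g => ?_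
    rw [mem_ofPred_eq, GL2.one_add_toOp_subOne]
    exact GL2.isUnit_toOp _

/-! ### Defining equations of the groups and their Lie algebras -/

variable {J : H →L[ℝ] H}

theorem mem_Sp2_iff {g : GL2 H} : g ∈ Sp2 J ↔ star g.toOp * J * g.toOp = J := by
  constructor
  · intro h
    ext ξ
    refine ext_inner_right ℝ fun η => ?_
    have := h ξ η
    rw [symplecticForm, ← ContinuousLinearMap.adjoint_inner_left] at this
    exact this
  · intro h ξ η
    rw [symplecticForm, symplecticForm, ← ContinuousLinearMap.adjoint_inner_left]
    exact congrArg (fun T : H →L[ℝ] H => inner ℝ (T ξ) η) h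

/-- The factor `1` is kept so that `cayley_form_iff` applies with `b = 1`. A left inverse of the
invertible `g` is two-sided, so one equation is enough. -/
theorem mem_U2_iff {g : GL2 H} : g ∈ U2 H ↔ star g.toOp * 1 * g.toOp = 1 := by
  rw [mul_one]
  constructor
  · exact fun h => Unitary.star_mul_self_of_mem h
  · intro h
    have e : (g⁻¹).toOp = star g.toOp := (left_inv_eq_right_inv h g.toOp_mul_inv).symm
    exact Unitary.mem_iff.2 ⟨h, e ▸ g.toOp_mul_inv⟩

theorem U2J_le_Sp2 : U2J J ≤ Sp2 J := by
  intro g hg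
  rw [mem_Sp2_iff, mul_assoc, ← hg.2, ← mul_assoc, Unitary.star_mul_self_of_mem hg.1, one_mul]

theorem mem_sp2_iff {x : HilbertSchmidt H} : x ∈ sp2 J ↔
    HilbertSchmidt.toOp H x * J = -(J * star (HilbertSchmidt.toOp H x)) := Iff.rfl

/-- Multiplying by `J` on both sides exchanges the two equations up to sign, since `J² = -1`. -/
theorem mem_sp2_iff' (hJ : J * J = -1) {x : HilbertSchmidt H} : x ∈ sp2 J ↔
    star (HilbertSchmidt.toOp H x) * J + J * HilbertSchmidt.toOp H x = 0 := by
  rw [mem_sp2_iff, ← add_eq_zero_iff_eq_neg]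
  set T := HilbertSchmidt.toOp H x
  have e : J * (star T * J + J * T) * J = -(T * J + J * star T) := by
    have : J * (star T * J + J * T) * J = J * star T * (J * J) + J * J * T * J := by noncomm_ring
    rw [this, hJ]
    noncomm_ring
  have e' : star T * J + J * T = J * (J * (star T * J + J * T) * J) * J := by
    have : J * (J * (star T * J + J * T) * J) * J = J * J * (star T * J + J * T) * (J * J) := by
      noncomm_ring
    rw [this, hJ]
    noncomm_ring
  constructor
  · intro h
    rw [e', e, h]; simp
  · intro h
    rw [← neg_eq_zero, ← e, h]; simp

variable (J) in
/-- The Lie algebra of `U₂(H_J)`: the skew-adjoint Hilbert-Schmidt operators commuting with `J`. -/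
def u2J : Submodule ℝ (HilbertSchmidt H) where
  carrier := {x | star (HilbertSchmidt.toOp H x) = -HilbertSchmidt.toOp H x ∧
    Commute (HilbertSchmidt.toOp H x) J}
  zero_mem' := by simp
  add_mem' {x y} hx hy := by
    refine ⟨?_, ?_⟩
    · rw [map_add, star_add, hx.1, hy.1, neg_add]
    · rw [map_add]; exact hx.2.add_left hy.2
  smul_mem' c x hx := by
    refine ⟨?_, ?_⟩
    · rw [map_smul, star_smul, hx.1, smul_neg]; simp
    · rw [map_smul]; exact hx.2.smul_left c

theorem mem_u2J_iff {x : HilbertSchmidt H} : x ∈ u2J J ↔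
    star (HilbertSchmidt.toOp H x) = -HilbertSchmidt.toOp H x ∧
      Commute (HilbertSchmidt.toOp H x) J := Iff.rfl

theorem u2J_le_sp2 : u2J J ≤ sp2 J := by
  intro x hx
  rw [mem_sp2_iff, hx.1, mul_neg, neg_neg]
  exact hx.2

theorem isClosed_sp2 : IsClosed (sp2 J : Set (HilbertSchmidt H)) := by
  have h1 : Continuous fun x : HilbertSchmidt H => HilbertSchmidt.toOp H x :=
    (toOpL (H := H)).continuous
  exact isClosed_eq (h1.mul continuous_const)
    (continuous_const.mul (ContinuousLinearMap.adjoint.continuous.comp h1)).neg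

theorem isClosed_u2J : IsClosed (u2J J : Set (HilbertSchmidt H)) := by
  have h1 : Continuous fun x : HilbertSchmidt H => HilbertSchmidt.toOp H x :=
    (toOpL (H := H)).continuous
  exact (isClosed_eq (ContinuousLinearMap.adjoint.continuous.comp h1) h1.neg).inter
    (isClosed_eq (h1.mul continuous_const) (continuous_const.mul h1))

/-! ### Projections onto the Lie algebras -/

variable (J) in
/-- Twice the projection of `B₂(H)` onto `𝔰𝔭₂(H)`. -/
def sp2Sum : HilbertSchmidt H →L[ℝ] HilbertSchmidt H :=
  ContinuousLinearMap.id ℝ _ + lmul J ∘L rmul J ∘L adj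

theorem toOp_sp2Sum (x : HilbertSchmidt H) : HilbertSchmidt.toOp H (sp2Sum J x) =
    HilbertSchmidt.toOp H x + J * (star (HilbertSchmidt.toOp H x) * J) := by
  change HilbertSchmidt.toOp H (x + lmul J (rmul J (adj x))) = _
  rw [map_add, toOp_lmul, toOp_rmul, toOp_adj, ContinuousLinearMap.star_eq_adjoint]

/-- The map `x ↦ J x* J` is an involution with fixed space `𝔰𝔭₂(H)`, so adding `x` to its image
gives a fixed point. -/
theorem sp2Sum_mem (hJ : J * J = -1) (hJ' : star J = -J) (x : HilbertSchmidt H) :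
    sp2Sum J x ∈ sp2 J := by
  rw [mem_sp2_iff, toOp_sp2Sum, star_add, star_mul, star_mul, star_star, hJ']
  set T := HilbertSchmidt.toOp H x
  have e1 : (T + J * (star T * J)) * J = T * J + J * star T * (J * J) := by noncomm_ring
  have e2 : J * (star T + -J * T * -J) = J * star T + J * J * T * J := by noncomm_ring
  rw [e1, e2, hJ]
  noncomm_ring

/-- The projection of `B₂(H)` onto `𝔰𝔭₂(H)`. -/
def sp2Proj (hJ : J * J = -1) (hJ' : star J = -J) : HilbertSchmidt H →L[ℝ] sp2 J :=
  (1 / 2 : ℝ) • (sp2Sum J).codRestrict (sp2 J) (sp2Sum_mem hJ hJ')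

theorem sp2Proj_apply (hJ : J * J = -1) (hJ' : star J = -J) (x : sp2 J) :
    sp2Proj hJ hJ' x = x := by
  apply Subtype.ext
  apply toOp_injective
  change HilbertSchmidt.toOp H ((1 / 2 : ℝ) • sp2Sum J x) = HilbertSchmidt.toOp H x
  have hx := mem_sp2_iff.1 x.2
  rw [map_smul, toOp_sp2Sum]
  set T := HilbertSchmidt.toOp H (x : HilbertSchmidt H)
  have e : J * (star T * J) = T := by
    have e1 : J * (star T * J) = -(-(J * star T)) * J := by noncomm_ring
    rw [e1, ← hx, neg_mul, mul_assoc, hJ, mul_neg, mul_one, neg_neg]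
  rw [e, ← two_smul ℝ T, smul_smul]
  norm_num

variable (J) in
/-- Four times the projection of `B₂(H)` onto the Lie algebra of `U₂(H_J)`. -/
def u2JSum : HilbertSchmidt H →L[ℝ] HilbertSchmidt H :=
  ContinuousLinearMap.id ℝ _ - adj - lmul J ∘L rmul J + lmul J ∘L rmul J ∘L adj

theorem toOp_u2JSum (x : HilbertSchmidt H) : HilbertSchmidt.toOp H (u2JSum J x) =
    HilbertSchmidt.toOp H x - star (HilbertSchmidt.toOp H x) - J * (HilbertSchmidt.toOp H x * J) +
      J * (star (HilbertSchmidt.toOp H x) * J) := by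
  change HilbertSchmidt.toOp H (x - adj x - lmul J (rmul J x) + lmul J (rmul J (adj x))) = _
  simp only [map_add, map_sub, toOp_lmul, toOp_rmul, toOp_adj, ContinuousLinearMap.star_eq_adjoint]

/-- The four terms are the orbit of `x` under the commuting involutions `x ↦ -x*` and `x ↦ -J x J`,
whose common fixed points are the skew-adjoint operators commuting with `J`. -/
theorem u2JSum_mem (hJ : J * J = -1) (hJ' : star J = -J) (x : HilbertSchmidt H) :
    u2JSum J x ∈ u2J J := by
  rw [mem_u2J_iff, toOp_u2JSum]
  set T := HilbertSchmidt.toOp H x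
  constructor
  · simp only [star_add, star_sub, star_mul, star_star, hJ']
    noncomm_ring
  · have e1 : (T - star T - J * (T * J) + J * (star T * J)) * J =
        T * J - star T * J - J * T * (J * J) + J * star T * (J * J) := by noncomm_ring
    have e2 : J * (T - star T - J * (T * J) + J * (star T * J)) =
        J * T - J * star T - J * J * T * J + J * J * star T * J := by noncomm_ring
    rw [Commute, SemiconjBy, e1, e2, hJ]
    noncomm_ring

/-- The projection of `B₂(H)` onto the Lie algebra of `U₂(H_J)`. -/
def u2JProj (hJ : J * J = -1) (hJ' : star J = -J) : HilbertSchmidt H →L[ℝ] u2J J :=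
  (1 / 4 : ℝ) • (u2JSum J).codRestrict (u2J J) (u2JSum_mem hJ hJ')

theorem u2JProj_apply (hJ : J * J = -1) (hJ' : star J = -J) (x : u2J J) :
    u2JProj hJ hJ' x = x := by
  apply Subtype.ext
  apply toOp_injective
  change HilbertSchmidt.toOp H ((1 / 4 : ℝ) • u2JSum J x) = HilbertSchmidt.toOp H x
  obtain ⟨hx, hx'⟩ := mem_u2J_iff.1 x.2
  rw [map_smul, toOp_u2JSum, hx]
  set T := HilbertSchmidt.toOp H (x : HilbertSchmidt H)
  have e : J * (T * J) = -T := by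
    rw [hx'.eq, ← mul_assoc, hJ, neg_mul, one_mul]
  have e' : T - -T - J * (T * J) + J * (-T * J) = (4 : ℝ) • T := by
    rw [neg_mul, mul_neg, e]
    module
  rw [e', smul_smul]
  norm_num

/-! ### The manifold structures and the inclusion -/

theorem mem_Sp2_iff_cayley (hJ : J * J = -1) {g : GL2 H}
    (hg : g.subOne ∈ (cayley (H := H)).source) : g ∈ Sp2 J ↔ cayley g.subOne ∈ sp2 J := by
  rw [mem_Sp2_iff, mem_sp2_iff' hJ, ← g.one_add_toOp_subOne,
    cayley_form_iff hg.1 (two_add_mul_cayley hg)]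

theorem mem_U2J_iff_cayley {g : GL2 H} (hg : g.subOne ∈ (cayley (H := H)).source) :
    g ∈ U2J J ↔ cayley g.subOne ∈ u2J J := by
  have hc : g.toOp * J = J * g.toOp ↔ Commute (HilbertSchmidt.toOp H g.subOne) J := by
    rw [GL2.toOp_subOne]
    refine ⟨fun h => Commute.sub_left h (Commute.one_left J), fun h => ?_⟩
    have := h.add_left (Commute.one_left J)
    rw [sub_add_cancel] at this
    exact this
  have hu : g ∈ U2J J ↔ g ∈ U2 H ∧ g.toOp * J = J * g.toOp := Iff.rfl
  rw [hu, hc, mem_u2J_iff, mem_U2_iff, cayley_commute_iff hg.1 (two_add_mul_cayley hg),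
    ← g.one_add_toOp_subOne, cayley_form_iff hg.1 (two_add_mul_cayley hg), mul_one, one_mul,
    add_eq_zero_iff_eq_neg]

/-- `Sp₂(H)` as an embedded submanifold. -/
def sp2Slices (hJ : J * J = -1) (hJ' : star J = -J) :
    SliceAtlas ℝ (HilbertSchmidt H) (sp2 J) (Sp2 J) ω :=
  cayleySlices (Sp2 J).subtype IsEmbedding.subtypeVal (sp2 J) (sp2Proj hJ hJ')
    (sp2Proj_apply hJ hJ') fun g hg => by
      rw [← mem_Sp2_iff_cayley hJ hg]
      simp

/-- `U₂(H_J)` as an embedded submanifold. -/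
def u2JSlices (hJ : J * J = -1) (hJ' : star J = -J) :
    SliceAtlas ℝ (HilbertSchmidt H) (u2J J) ((U2J J).subgroupOf (Sp2 J)) ω :=
  cayleySlices ((Sp2 J).subtype.comp ((U2J J).subgroupOf (Sp2 J)).subtype)
    (IsEmbedding.subtypeVal.comp IsEmbedding.subtypeVal) (u2J J) (u2JProj hJ hJ')
    (u2JProj_apply hJ hJ') fun g hg => by
      rw [← mem_U2J_iff_cayley hg]
      constructor
      · rintro ⟨x, rfl⟩
        exact x.2
      · exact fun h => ⟨⟨⟨g, U2J_le_Sp2 h⟩, h⟩, rfl⟩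

theorem isSp2LieStructure (hJ : J * J = -1) (hJ' : star J = -J) :
    IsSp2LieStructure J (sp2Slices hJ hJ').chartedSpace := by
  let S := sp2Slices hJ hJ'
  let := S.chartedSpace
  have := S.isManifold
  exact ⟨isClosed_sp2.completeSpace_coe,
    lieGroup_of_isSmoothEmbedding (Sp2 J).subtype S.isSmoothEmbedding, S.isSmoothEmbedding⟩

/-- At a point of `U₂(H_J)` both slice atlases use the same ambient chart, so the inclusion of
groups reads as the inclusion `u2J J ≤ sp2 J`, split by the restriction of `u2JProj`. Only the
manifold structure and the immersion property are needed from `A`. -/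
theorem isBanachLieSubgroup_U2J (hJ : J * J = -1) (hJ' : star J = -J)
    (A : ChartedSpace (sp2 J) (Sp2 J)) (hA : IsSp2LieStructure J A) :
    IsBanachLieSubgroup (sp2 J) ((U2J J).subgroupOf (Sp2 J)) := by
  let S := sp2Slices hJ hJ'
  let T := u2JSlices hJ hJ'
  have := hA.lieGroup
  let := T.chartedSpace
  have := T.isManifold
  refine ⟨u2J J, inferInstance, inferInstance, T.chartedSpace, isClosed_u2J.completeSpace_coe,
    lieGroup_of_isSmoothEmbedding _ T.isSmoothEmbedding, ?_⟩
  exact S.isSmoothEmbedding_map T hA.embedding.isImmersion (fun _ => rfl)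
    ((u2J J).subtypeL.codRestrict (sp2 J) fun x => u2J_le_sp2 x.2)
    (u2JProj hJ hJ' ∘L (sp2 J).subtypeL) (u2JProj_apply hJ hJ') (fun _ => rfl) (fun _ => rfl)

end RestrictedSymplectic

end

theorem mainTheorem9 {H : Type*} [NormedAddCommGroup H] [InnerProductSpace ℝ H] [CompleteSpace H]
    (J : H →L[ℝ] H) (hJ : J * J = -1) (hJ' : ContinuousLinearMap.adjoint J = -J) :
    RestrictedSymplectic.U2J J ≤ RestrictedSymplectic.Sp2 J ∧
    (∃ A : ChartedSpace (RestrictedSymplectic.sp2 J) (RestrictedSymplectic.Sp2 J),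
      RestrictedSymplectic.IsSp2LieStructure J A) ∧
    ∀ A : ChartedSpace (RestrictedSymplectic.sp2 J) (RestrictedSymplectic.Sp2 J),
      RestrictedSymplectic.IsSp2LieStructure J A →
      RestrictedSymplectic.IsBanachLieSubgroup (RestrictedSymplectic.sp2 J)
        ((RestrictedSymplectic.U2J J).subgroupOf (RestrictedSymplectic.Sp2 J)) :=
  ⟨RestrictedSymplectic.U2J_le_Sp2, ⟨_, RestrictedSymplectic.isSp2LieStructure hJ hJ'⟩,
    RestrictedSymplectic.isBanachLieSubgroup_U2J hJ hJ'⟩
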